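/- Let $a<b$ be real numbers and let $\gamma:[a,b]\to\mathbb{C}$ be an analytic simple arc: there are an open set $V\subseteq\mathbb{C}$ with $[a,b]\subseteq V$ and an injective holomorphic function $F:V\to\mathbb{C}$ with $F|_{[a,b]}=\gamma$. Fix any such $V$ and $F$, write $\gamma^*=\gamma([a,b])$, and put $$K(\gamma,+)=F(\{z\in V:\operatorname{Im} z>0\}),\qquad K(\gamma,-)=F(\{z\in V:\operatorname{Im} z<0\}).$$ For $k\in\{0,1,2,\dots\}\cup\{\infty\}$ let $C^k(\gamma^*)$ be the space of functions $u:\gamma^*\to\mathbb{C}$ such that $u\circ\gamma$ is $k$ times continuously differentiable on $[a,b]$, with the topology defined by the seminorms $u\mapsto\sup_{t\in[a,b]}|(u\circ\gamma)^{(l)}(t)|$, where $l$ runs over the integers with $0\le l\le k$ (over all $l\ge 0$ if $k=\infty$). For $K\in\{K(\gamma,+),K(\gamma,-)\}$ say that $u\in C^k(\gamma^*)$ is extendable from the side $K$ if there are a domain $W\subseteq\mathbb{C}$ with $W\cap\gamma^*\neq\emptyset$ and a continuous function $\lambda:\gamma^*\cup(W\cap K)\to\mathbb{C}$ that is holomorphic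 on $W\cap K$ and satisfies $\lambda=u$ on $W\cap\gamma^*$. Define the following subsets of $C^k(\gamma^*)$: - $U_2(\gamma^*,k)$: the functions that are not extendable from the side $K(\gamma,+)$; - $U_3(\gamma^*,k)$: the functions that are not extendable from the side $K(\gamma,-)$; - $U_4(\gamma^*,k)$: the functions that are extendable neither from the side $K(\gamma,+)$ nor from the side $K(\gamma,-)$; - $U_5(\gamma^*,k)$: the functions $u$ for which there are no $z_0\in\gamma^*$, $r>0$ and holomorphic $f:D(z_0,r)\to\mathbb{C}$ with $f=u$ on $D(z_0,r)\cap\gamma^*$, where $D(z_0,r)$ is the open disc with centre $z_0$ and radius $r$. Then, for every $k\in\{0,1,2,\dots\}\cup\{\infty\}$, each of $U_2(\gamma^*,k)$, $U_3(\gamma^*,k)$, $U_4(\gamma^*,k)$ and $U_5(\gamma^*,k)$ is a dense $G_\delta$ subset of $C^k(\gamma^*)$. -/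

import Mathlib

open Set

noncomputable section

namespace AnalyticArc

/-- `F : V → ℂ` exhibits `γ : [a,b] → ℂ` as an analytic simple curve: `V ⊆ ℂ` is an open set
containing `[a,b]`, `F` is holomorphic and injective on `V`, and `F = γ` on `[a,b]`.
(The values of `F` outside `V` are irrelevant.) -/
structure IsAnalyticExtension {a b : ℝ} (γ : Icc a b → ℂ) (V : Set ℂ) (F : ℂ → ℂ) : Prop where
  isOpen : IsOpen V
  mem : ∀ t : Icc a b, ((t : ℝ) : ℂ) ∈ V
  holomorphic : DifferentiableOn ℂ F V
  injective : InjOn F V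
  eq_curve : ∀ t : Icc a b, F ((t : ℝ) : ℂ) = γ t

variable {a b : ℝ}

/-- The function `u ∘ γ` on `[a,b]`, for `u` a function on the trace `γ* = range γ`. Only its
values on `[a,b]` matter below; it is continued by constants to a function on `ℝ`. -/
def pullback (hab : a < b) (γ : Icc a b → ℂ) (u : range γ → ℂ) : ℝ → ℂ :=
  IccExtend hab.le (fun t => u ⟨γ t, mem_range_self t⟩)

/-- The functions `u : γ* → ℂ` such that `u ∘ γ` is `k` times continuously differentiable
on `[a,b]` (one-sided derivatives at the end points), as a complex vector space. -/
def ckSubmodule (hab : a < b) (γ : Icc a b → ℂ) (k : ℕ∞) : Submodule ℂ (range γ → ℂ) where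
  carrier := {u | ContDiffOn ℝ k (pullback hab γ u) (Icc a b)}
  add_mem' := fun hu hv => ContDiffOn.add hu hv
  zero_mem' := contDiffOn_const (c := (0 : ℂ))
  smul_mem' := fun c _ hu => ContDiffOn.const_smul c hu

/-- The space `C^k(γ*)`, `k = 0, 1, 2, …` or `∞`. It is a type of its own, so that it does not
inherit the topology of pointwise convergence. -/
def Ck (hab : a < b) (γ : Icc a b → ℂ) (k : ℕ∞) : Type := ckSubmodule hab γ k

variable {hab : a < b} {γ : Icc a b → ℂ} {k : ℕ∞}

instance : AddCommGroup (Ck hab γ k) := inferInstanceAs (AddCommGroup (ckSubmodule hab γ k))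

instance : Module ℂ (Ck hab γ k) := inferInstanceAs (Module ℂ (ckSubmodule hab γ k))

/-- The function on `γ*` underlying an element of `C^k(γ*)`. -/
def Ck.toFun (u : Ck hab γ k) : range γ → ℂ := Subtype.val u

theorem Ck.contDiffOn (u : Ck hab γ k) : ContDiffOn ℝ k (pullback hab γ u.toFun) (Icc a b) :=
  Subtype.prop u

/-- The `l`-th derivative `(u ∘ γ)^(l)`, a continuous function on `[a,b]`, for `l ≤ k`. -/
def Ck.derivMap (l : {l : ℕ // (l : ℕ∞) ≤ k}) : Ck hab γ k →ₗ[ℂ] C(Icc a b, ℂ) where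
  toFun u :=
    { toFun := fun t => iteratedDerivWithin l (pullback hab γ u.toFun) (Icc a b) t
      continuous_toFun := continuousOn_iff_continuous_domRestrict.1
        (u.contDiffOn.continuousOn_iteratedDerivWithin
          (by exact_mod_cast l.2) (uniqueDiffOn_Icc hab)) }
  map_add' u v := by
    ext t
    have h : ((l : ℕ) : WithTop ℕ∞) ≤ (k : WithTop ℕ∞) := by exact_mod_cast l.2
    exact iteratedDerivWithin_add t.2 (uniqueDiffOn_Icc hab)
      ((u.contDiffOn.of_le h) t t.2) ((v.contDiffOn.of_le h) t t.2)
  map_smul' c u := by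
    ext t
    have h : ((l : ℕ) : WithTop ℕ∞) ≤ (k : WithTop ℕ∞) := by exact_mod_cast l.2
    exact iteratedDerivWithin_const_smul t.2 (uniqueDiffOn_Icc hab) c
      ((u.contDiffOn.of_le h) t t.2)

/-- The seminorms `u ↦ sup_{t ∈ [a,b]} |(u ∘ γ)^(l)(t)|`, `l ≤ k` (all `l` if `k = ∞`); the norm
of `C(Icc a b, ℂ)` is the maximum norm. -/
def Ck.seminorms (hab : a < b) (γ : Icc a b → ℂ) (k : ℕ∞) :
    SeminormFamily ℂ (Ck hab γ k) {l : ℕ // (l : ℕ∞) ≤ k} :=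
  fun l => (normSeminorm ℂ C(Icc a b, ℂ)).comp (Ck.derivMap l)

/-- The topology of `C^k(γ*)`: the one defined by the above seminorms. -/
instance : TopologicalSpace (Ck hab γ k) := (Ck.seminorms hab γ k).moduleFilterBasis.topology

/-- `K(γ,+) = F({Im z > 0} ∩ V)`. -/
def sidePlus (V : Set ℂ) (F : ℂ → ℂ) : Set ℂ := F '' ({z | 0 < z.im} ∩ V)

/-- `K(γ,-) = F({Im z < 0} ∩ V)`. -/
def sideMinus (V : Set ℂ) (F : ℂ → ℂ) : Set ℂ := F '' ({z | z.im < 0} ∩ V)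

/-- `u` is extendable from the side `K`: there are a domain `W` meeting `γ*` and a function `g`,
continuous on `γ* ∪ (W ∩ K)` and holomorphic on `W ∩ K`, with `g = u` on `W ∩ γ*`. -/
def ExtendableFromSide (γ : Icc a b → ℂ) (K : Set ℂ) (u : range γ → ℂ) : Prop :=
  ∃ W : Set ℂ, IsOpen W ∧ IsConnected W ∧ (W ∩ range γ).Nonempty ∧
    ∃ g : ℂ → ℂ, ContinuousOn g (range γ ∪ (W ∩ K)) ∧ DifferentiableOn ℂ g (W ∩ K) ∧
      ∀ z : range γ, (z : ℂ) ∈ W → g z = u z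

/-- `u` is extendable to a disc: there are a disc `D(z₀,r)`, `z₀ ∈ γ*`, `r > 0`, and a
holomorphic function `f` on it with `f = u` on `D(z₀,r) ∩ γ*`. -/
def ExtendableToDisc (γ : Icc a b → ℂ) (u : range γ → ℂ) : Prop :=
  ∃ z₀ ∈ range γ, ∃ r : ℝ, 0 < r ∧
    ∃ f : ℂ → ℂ, DifferentiableOn ℂ f (Metric.ball z₀ r) ∧
      ∀ z : range γ, (z : ℂ) ∈ Metric.ball z₀ r → f z = u z

/-- Functions in `C^k(γ*)` not extendable from the side `K(γ,+)`. -/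
def U₂ (hab : a < b) (γ : Icc a b → ℂ) (V : Set ℂ) (F : ℂ → ℂ) (k : ℕ∞) : Set (Ck hab γ k) :=
  {u | ¬ ExtendableFromSide γ (sidePlus V F) u.toFun}

/-- Functions in `C^k(γ*)` not extendable from the side `K(γ,-)`. -/
def U₃ (hab : a < b) (γ : Icc a b → ℂ) (V : Set ℂ) (F : ℂ → ℂ) (k : ℕ∞) : Set (Ck hab γ k) :=
  {u | ¬ ExtendableFromSide γ (sideMinus V F) u.toFun}

/-- Functions in `C^k(γ*)` extendable neither from `K(γ,+)` nor from `K(γ,-)`. -/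
def U₄ (hab : a < b) (γ : Icc a b → ℂ) (V : Set ℂ) (F : ℂ → ℂ) (k : ℕ∞) : Set (Ck hab γ k) :=
  {u | ¬ ExtendableFromSide γ (sidePlus V F) u.toFun ∧
    ¬ ExtendableFromSide γ (sideMinus V F) u.toFun}

/-- Functions in `C^k(γ*)` not extendable to any disc centred on `γ*`. -/
def U₅ (hab : a < b) (γ : Icc a b → ℂ) (k : ℕ∞) : Set (Ck hab γ k) :=
  {u | ¬ ExtendableToDisc γ u.toFun}

end AnalyticArc

end

open Set Filter Topology

namespace AnalyticArc

/-! Composing with `F` and its holomorphic inverse turns extendability from a side into a question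
on the real line: does `u ∘ γ` extend over some segment to a half-square, continuously up to the
boundary and holomorphically inside? The sign `σ = ±1` selects the side. Everything rests on a
two-constants estimate (`norm_le_of_norm_le_real`): a holomorphic function bounded on a half-square
and very small on its real edge is small on a quarter-size half-square.

G_δ: cover the extendable functions by countably many sets, indexed by rational half-squares and
integer bounds. By the estimate, uniform convergence on the segment forces uniform convergence of
extensions with a common bound, so limits still extend to a smaller half-square. Hence the closures
of these sets, taken in the uniform norm, contain only extendable functions
(`isGδ_compl_of_closure`). The disc case uses the estimate on both sides of the axis.

Density: a half-extension is determined by its values on any subsegment (`IsHalfExtension.eq_zero`),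
so bump functions fail to extend over suitable segments. Baire's theorem in a space of bounded
coefficient sequences then yields one smooth `v` with no half-extension anywhere. With `u₀` the
transplant of `v` to the arc, for each `u` only countably many real `ε` are bad for `u + ε u₀`,
since two bad values for the same rational half-square would extend `u₀`. One dense set therefore
serves all four families, and Baire's theorem is never needed in `C^k(γ*)` itself. -/

/-- The open half-square over `(c - r, c + r)`, on the side `0 < σ * Im z` of the real line. -/
def halfSquare (σ c r : ℝ) : Set ℂ := {z | |z.re - c| < r ∧ 0 < σ * z.im ∧ σ * z.im < r}

/-- The closed half-square over `[c - r, c + r]`, on the side `0 ≤ σ * Im z` of the real line. -/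
def closedHalfSquare (σ c r : ℝ) : Set ℂ := {z | |z.re - c| ≤ r ∧ 0 ≤ σ * z.im ∧ σ * z.im ≤ r}

/-- `G` is continuous on the closed half-square, holomorphic on the open one, and equal to `v` on
the real segment `[c - r, c + r]`. -/
structure IsHalfExtension (σ c r : ℝ) (v : ℝ → ℂ) (G : ℂ → ℂ) : Prop where
  continuousOn : ContinuousOn G (closedHalfSquare σ c r)
  differentiableOn : DifferentiableOn ℂ G (halfSquare σ c r)
  eq_real : ∀ x : ℝ, |x - c| ≤ r → G x = v x

/-! ### Topology and geometry of half-squares. -/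

theorem isOpen_halfSquare (σ c r : ℝ) : IsOpen (halfSquare σ c r) := by
  have h1 : IsOpen {z : ℂ | |z.re - c| < r} := isOpen_lt (by fun_prop) (by fun_prop)
  have h2 : IsOpen {z : ℂ | 0 < σ * z.im} := isOpen_lt (by fun_prop) (by fun_prop)
  have h3 : IsOpen {z : ℂ | σ * z.im < r} := isOpen_lt (by fun_prop) (by fun_prop)
  exact h1.inter (h2.inter h3)

theorem isClosed_closedHalfSquare (σ c r : ℝ) : IsClosed (closedHalfSquare σ c r) := by
  have h1 : IsClosed {z : ℂ | |z.re - c| ≤ r} := isClosed_le (by fun_prop) (by fun_prop)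
  have h2 : IsClosed {z : ℂ | 0 ≤ σ * z.im} := isClosed_le (by fun_prop) (by fun_prop)
  have h3 : IsClosed {z : ℂ | σ * z.im ≤ r} := isClosed_le (by fun_prop) (by fun_prop)
  exact h1.inter (h2.inter h3)

theorem halfSquare_subset_closed (σ c r : ℝ) : halfSquare σ c r ⊆ closedHalfSquare σ c r :=
  fun _ h => ⟨h.1.le, h.2.1.le, h.2.2.le⟩

theorem closure_halfSquare_subset (σ c r : ℝ) :
    closure (halfSquare σ c r) ⊆ closedHalfSquare σ c r :=
  closure_minimal (halfSquare_subset_closed σ c r) (isClosed_closedHalfSquare σ c r)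

theorem closedHalfSquare_subset {σ c r d s : ℝ} (h : |d - c| + s ≤ r) :
    closedHalfSquare σ d s ⊆ closedHalfSquare σ c r := by
  rintro z ⟨h1, h2, h3⟩
  have := abs_sub_le z.re d c
  have := abs_nonneg (d - c)
  exact ⟨by linarith, h2, by linarith⟩

theorem halfSquare_subset {σ c r d s : ℝ} (h : |d - c| + s ≤ r) :
    halfSquare σ d s ⊆ halfSquare σ c r := by
  rintro z ⟨h1, h2, h3⟩
  have := abs_sub_le z.re d c
  have := abs_nonneg (d - c)
  exact ⟨by linarith, h2, by linarith⟩

theorem ofReal_mem_closedHalfSquare {σ c r x : ℝ} (h : |x - c| ≤ r) :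
    (x : ℂ) ∈ closedHalfSquare σ c r :=
  ⟨by simpa using h, by simp, by simpa using (abs_nonneg _).trans h⟩

theorem isPreconnected_halfSquare (σ c r : ℝ) : IsPreconnected (halfSquare σ c r) := by
  apply Convex.isPreconnected
  have : halfSquare σ c r = Complex.reLm ⁻¹' (Ioo (c - r) (c + r)) ∩
      (σ • Complex.imLm) ⁻¹' (Ioo 0 r) := by
    ext z
    simp only [halfSquare, mem_ofPred_eq, abs_lt, mem_inter_iff, mem_preimage, mem_Ioo,
      Complex.reLm_coe, LinearMap.smul_apply, Complex.imLm_coe, smul_eq_mul]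
    constructor
    · rintro ⟨⟨h1, h2⟩, h3⟩
      exact ⟨⟨by linarith, by linarith⟩, h3⟩
    · rintro ⟨⟨h1, h2⟩, h3⟩
      exact ⟨⟨by linarith, by linarith⟩, h3⟩
  rw [this]
  exact ((convex_Ioo _ _).linear_preimage _).inter ((convex_Ioo _ _).linear_preimage _)

theorem halfSquare_nonempty {σ : ℝ} (hσ : σ ^ 2 = 1) (c : ℝ) {r : ℝ} (hr : 0 < r) :
    (halfSquare σ c r).Nonempty := by
  refine ⟨⟨c, σ * (r / 2)⟩, by simpa using hr, ?_, ?_⟩ <;>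
  · have : σ * (σ * (r / 2)) = r / 2 := by rw [← mul_assoc, ← sq, hσ, one_mul]
    simp only [this]; linarith

theorem ofReal_mem_closure_halfSquare {σ : ℝ} (hσ : σ ^ 2 = 1) {c r x : ℝ} (hr : 0 < r)
    (h : |x - c| ≤ r) : (x : ℂ) ∈ closure (halfSquare σ c r) := by
  have hlim : Tendsto (fun t : ℝ => (⟨x + t * (c - x), t * (σ * (r / 2))⟩ : ℂ)) (𝓝[>] 0)
      (𝓝 (x : ℂ)) := by
    have hc : Continuous fun t : ℝ => (⟨x + t * (c - x), t * (σ * (r / 2))⟩ : ℂ) := by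
      have : (fun t : ℝ => (⟨x + t * (c - x), t * (σ * (r / 2))⟩ : ℂ)) =
          fun t : ℝ => ((x + t * (c - x) : ℝ) : ℂ) + ((t * (σ * (r / 2)) : ℝ) : ℂ) * Complex.I := by
        funext t
        apply Complex.ext <;> simp
      rw [this]
      fun_prop
    have h0 := hc.tendsto 0
    have e : (⟨x + 0 * (c - x), 0 * (σ * (r / 2))⟩ : ℂ) = x := by
      apply Complex.ext <;> simp
    rw [e] at h0
    exact h0.mono_left nhdsWithin_le_nhds
  refine mem_closure_of_tendsto hlim ?_
  filter_upwards [Ioo_mem_nhdsGT (zero_lt_one' ℝ)] with t ht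
  have e1 : x + t * (c - x) - c = (1 - t) * (x - c) := by ring
  have e2 : σ * (t * (σ * (r / 2))) = t * (r / 2) := by
    linear_combination (t * (r / 2)) * hσ
  refine ⟨?_, ?_, ?_⟩
  · show |x + t * (c - x) - c| < r
    rw [e1, abs_mul, abs_of_pos (by linarith [ht.2])]
    nlinarith [ht.1, ht.2]
  · show 0 < σ * (t * (σ * (r / 2)))
    rw [e2]; exact mul_pos ht.1 (by linarith)
  · show σ * (t * (σ * (r / 2))) < r
    rw [e2]; nlinarith [ht.1, ht.2]

theorem closedHalfSquare_subset_ball {σ : ℝ} (hσ : σ ^ 2 = 1) (c : ℝ) {r : ℝ} (hr : 0 < r) :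
    closedHalfSquare σ c r ⊆ Metric.ball (c : ℂ) (2 * r) := by
  rintro z ⟨h1, h2, h3⟩
  rw [mem_ball_iff_norm]
  refine lt_of_pow_lt_pow_left₀ 2 (by positivity) ?_
  rw [Complex.sq_norm, Complex.normSq_apply]
  simp only [Complex.sub_re, Complex.ofReal_re, Complex.sub_im, Complex.ofReal_im, sub_zero]
  have := sq_le_sq' (abs_le.1 h1).1 (abs_le.1 h1).2
  have h4 : (σ * z.im) ^ 2 ≤ r ^ 2 := by gcongr
  rw [mul_pow, hσ] at h4
  nlinarith [sq_pos_of_pos hr]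

theorem eq_ofReal_of_im_eq_zero {z : ℂ} (h : z.im = 0) : z = (z.re : ℂ) :=
  Complex.ext rfl (by simpa using h)

/-! ### The two-constants estimate. -/

/-- Maximum principle for `G * exp P`, where `Re P` is nonpositive on the three non-real edges, at
most `N r²` on the real edge, and at least `N r² / 4` on the small half-square. Large `N` gains
decay inside at the cost of a factor on the real edge only. -/
theorem norm_le_of_norm_le_real {σ : ℝ} (hσ : σ ^ 2 = 1) {c r : ℝ} (hr : 0 < r) {G : ℂ → ℂ}
    (hc : ContinuousOn G (closedHalfSquare σ c r)) (hd : DifferentiableOn ℂ G (halfSquare σ c r))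
    {M ε N : ℝ} (hN : 0 ≤ N) (hM : ∀ z ∈ closedHalfSquare σ c r, ‖G z‖ ≤ M)
    (hε : ∀ x : ℝ, |x - c| ≤ r → ‖G x‖ ≤ ε) {z : ℂ} (hz : z ∈ closedHalfSquare σ c (r / 4)) :
    ‖G z‖ ≤ max (ε * Real.exp (N * r ^ 2)) M * Real.exp (-(N * (r ^ 2 / 4))) := by
  have hε0 : 0 ≤ ε := (norm_nonneg _).trans (hε c (by simpa using hr.le))
  have hM0 : 0 ≤ M := (norm_nonneg _).trans
    (hM c (ofReal_mem_closedHalfSquare (by simpa using hr.le)))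
  -- With `x = Re w - c` and `y = σ Im w`, `Re P = N (r² - x² + y² - 2 r y)`: this is `-N x²` on the
  -- edge `y = r`, and `N y (y - 2r) ≤ 0` on the edges `|x| = r`.
  let P : ℂ → ℂ := fun w => N * (r ^ 2 - (w - c) ^ 2 + 2 * Complex.I * σ * r * (w - c))
  have hP : ∀ w, (P w).re = N * (r ^ 2 - (w.re - c) ^ 2 + w.im ^ 2 - 2 * r * (σ * w.im)) := by
    intro w
    simp only [P, sq, Complex.add_re, Complex.sub_re, Complex.mul_re,
      Complex.ofReal_re, Complex.ofReal_im, Complex.sub_im, Complex.I_re, Complex.I_im,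
      Complex.mul_im, Complex.re_ofNat, Complex.im_ofNat]
    ring
  have hPd : Differentiable ℂ P := by fun_prop
  let H : ℂ → ℂ := fun w => G w * Complex.exp (P w)
  have hH : ∀ w, ‖H w‖ = ‖G w‖ * Real.exp (P w).re := fun w => by
    simp [H, Complex.norm_exp]
  have hσi : ∀ w : ℂ, w.im ^ 2 = (σ * w.im) ^ 2 := fun w => by rw [mul_pow, hσ, one_mul]
  have key : ‖H z‖ ≤ max (ε * Real.exp (N * r ^ 2)) M := by
    have hsub : closedHalfSquare σ c (r / 4) ⊆ closedHalfSquare σ c r :=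
      closedHalfSquare_subset (by simp; linarith)
    have hbound : ∀ w ∈ frontier (halfSquare σ c r),
        ‖H w‖ ≤ max (ε * Real.exp (N * r ^ 2)) M := by
      intro w hw
      have hw1 := closure_halfSquare_subset σ c r (frontier_subset_closure hw)
      have hw2 : w ∉ halfSquare σ c r := by
        rw [(isOpen_halfSquare σ c r).frontier_eq] at hw
        exact hw.2
      have hre := hP w
      rw [hσi] at hre
      obtain ⟨h1, h2, h3⟩ := id hw1
      have hsq := sq_le_sq' (abs_le.1 h1).1 (abs_le.1 h1).2
      rw [hH]
      rcases h2.eq_or_lt with h0 | h0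
      · have him : w.im = 0 := by
          rcases mul_eq_zero.1 h0.symm with h | h
          · simp [h] at hσ
          · exact h
        refine le_max_of_le_left ?_
        have hx := eq_ofReal_of_im_eq_zero him
        have hG : ‖G w‖ ≤ ε := by
          rw [hx]
          exact hε _ h1
        have : (P w).re ≤ N * r ^ 2 := by
          rw [hre, ← h0]
          apply mul_le_mul_of_nonneg_left _ hN
          nlinarith
        gcongr
      · refine le_max_of_le_right ?_
        have hneg : (P w).re ≤ 0 := by
          rw [hre]
          apply mul_nonpos_of_nonneg_of_nonpos hN
          by_cases hr1 : |w.re - c| < r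
          · have h4 : σ * w.im = r := by
              by_contra h4
              exact hw2 ⟨hr1, h0, lt_of_le_of_ne h3 h4⟩
            rw [h4]
            nlinarith [sq_nonneg (w.re - c)]
          · have h4 : (w.re - c) ^ 2 = r ^ 2 := by
              rw [← sq_abs, le_antisymm h1 (not_lt.1 hr1)]
            rw [h4]
            nlinarith
        calc ‖G w‖ * Real.exp (P w).re ≤ M * 1 := by
              gcongr
              · exact hM w hw1
              · simpa using hneg
          _ = M := mul_one M
    -- A point of the small half-square outside the open large one is real, hence on the frontier,
    -- where the bound is already known.
    by_cases him : z ∈ halfSquare σ c r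
    · refine Complex.norm_le_of_forall_mem_frontier_norm_le
        (Metric.isBounded_ball.subset ((halfSquare_subset_closed σ c r).trans
          (closedHalfSquare_subset_ball hσ c hr))) ⟨?_, ?_⟩ hbound (subset_closure him)
      · exact hd.mul (hPd.cexp.differentiableOn)
      · exact (hc.mono (closure_halfSquare_subset σ c r)).mul hPd.cexp.continuous.continuousOn
    · apply hbound
      have him0 : z.im = 0 := by
        by_contra h
        obtain ⟨h1, h2, h3⟩ := hz
        refine him ⟨by linarith, lt_of_le_of_ne h2 ?_, by linarith⟩
        refine (mul_ne_zero ?_ h).symm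
        rintro rfl
        simp at hσ
      rw [(isOpen_halfSquare σ c r).frontier_eq]
      refine ⟨?_, him⟩
      rw [eq_ofReal_of_im_eq_zero him0]
      exact ofReal_mem_closure_halfSquare hσ hr (hsub hz).1
  have hre : N * (r ^ 2 / 4) ≤ (P z).re := by
    rw [hP, hσi]
    obtain ⟨h1, h2, h3⟩ := hz
    have := sq_le_sq' (abs_le.1 h1).1 (abs_le.1 h1).2
    apply mul_le_mul_of_nonneg_left _ hN
    nlinarith
  rw [hH] at key
  rw [Real.exp_neg, ← div_eq_mul_inv, le_div_iff₀ (Real.exp_pos _)]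
  refine le_trans ?_ key
  gcongr


theorem exists_norm_le_of_norm_le_real (M : ℝ) {r δ : ℝ} (hr : 0 < r) (hδ : 0 < δ) :
    ∃ ε > 0, ∀ {σ : ℝ}, σ ^ 2 = 1 → ∀ {c : ℝ} {G : ℂ → ℂ},
      ContinuousOn G (closedHalfSquare σ c r) → DifferentiableOn ℂ G (halfSquare σ c r) →
      (∀ z ∈ closedHalfSquare σ c r, ‖G z‖ ≤ M) → (∀ x : ℝ, |x - c| ≤ r → ‖G x‖ ≤ ε) →
      ∀ z ∈ closedHalfSquare σ c (r / 4), ‖G z‖ ≤ δ := by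
  have hlim : Tendsto (fun N : ℝ => max M 1 * Real.exp (-(N * (r ^ 2 / 4)))) atTop (𝓝 0) := by
    have h : Tendsto (fun N : ℝ => N * (r ^ 2 / 4)) atTop atTop :=
      tendsto_id.atTop_mul_const (by positivity)
    simpa using (Real.tendsto_exp_neg_atTop_nhds_zero.comp h).const_mul (max M 1)
  obtain ⟨N, hN, hN0⟩ := ((hlim.eventually_lt_const hδ).and (eventually_ge_atTop 0)).exists
  -- This `ε` makes `ε * exp (N r²)` equal to the bound `max M 1`, so both entries of the maximum
  -- coincide; the `1` keeps `ε` positive for every `M`.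
  refine ⟨max M 1 * Real.exp (-(N * r ^ 2)), by positivity, ?_⟩
  intro σ hσ c G hc hd hM hε z hz
  have := norm_le_of_norm_le_real hσ hr hc hd hN0 (fun z hz => (hM z hz).trans (le_max_left M 1))
    hε hz
  rw [mul_assoc, ← Real.exp_add, neg_add_cancel, Real.exp_zero, mul_one, max_self] at this
  exact this.trans hN.le

/-! ### Half-extensions: linearity, uniqueness, uniform limits. -/

namespace IsHalfExtension

variable {σ c r : ℝ} {v w : ℝ → ℂ} {G H : ℂ → ℂ}

theorem sub (hG : IsHalfExtension σ c r v G) (hH : IsHalfExtension σ c r w H) :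
    IsHalfExtension σ c r (v - w) (G - H) :=
  ⟨hG.continuousOn.sub hH.continuousOn, hG.differentiableOn.sub hH.differentiableOn,
    fun x hx => by simp [hG.eq_real x hx, hH.eq_real x hx]⟩

theorem const_smul (a : ℂ) (hG : IsHalfExtension σ c r v G) :
    IsHalfExtension σ c r (a • v) (a • G) :=
  ⟨hG.continuousOn.const_smul a, hG.differentiableOn.const_smul a,
    fun x hx => by simp [hG.eq_real x hx]⟩

theorem congr (hG : IsHalfExtension σ c r v G) (h : ∀ x, |x - c| ≤ r → v x = w x) :
    IsHalfExtension σ c r w G :=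
  ⟨hG.continuousOn, hG.differentiableOn, fun x hx => (hG.eq_real x hx).trans (h x hx)⟩

theorem mono {d s : ℝ} (hG : IsHalfExtension σ c r v G) (h : |d - c| + s ≤ r) :
    IsHalfExtension σ d s v G := by
  refine ⟨hG.continuousOn.mono (closedHalfSquare_subset h),
    hG.differentiableOn.mono (halfSquare_subset h), fun x hx => hG.eq_real x ?_⟩
  have := abs_sub_le x d c
  linarith

/-- A half-extension of a function that vanishes on a segment vanishes on the real axis. -/
theorem eq_zero (hσ : σ ^ 2 = 1) {d s : ℝ} (hG : IsHalfExtension σ c r v G) (hs : 0 < s)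
    (h : |d - c| + s ≤ r) (hv : ∀ x, |x - d| ≤ s → v x = 0) {x : ℝ} (hx : |x - c| ≤ r) :
    v x = 0 := by
  have hr : 0 < r := by have := abs_nonneg (d - c); linarith
  have hG' := hG.mono h
  obtain ⟨M, hM⟩ : ∃ M, ∀ z ∈ closedHalfSquare σ d s, ‖G z‖ ≤ M :=
    (Metric.isCompact_of_isClosed_isBounded (isClosed_closedHalfSquare σ d s)
      (Metric.isBounded_ball.subset (closedHalfSquare_subset_ball hσ d hs))).exists_bound_of_continuousOn
      hG'.continuousOn
  -- The values on the real edge lie below every `ε`, so the estimate gives `‖G z‖ ≤ δ` for every `δ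
  -- > 0`. The identity theorem and continuity then spread the zero to the whole closure.
  have hzero : ∀ z ∈ closedHalfSquare σ d (s / 4), G z = 0 := by
    intro z hz
    rw [← norm_le_zero_iff]
    refine le_of_forall_pos_le_add fun δ hδ => ?_
    obtain ⟨ε, hε, hle⟩ := exists_norm_le_of_norm_le_real M hs hδ
    rw [zero_add]
    refine hle hσ hG'.continuousOn hG'.differentiableOn hM (fun y hy => ?_) z hz
    rw [hG'.eq_real y hy, hv y hy, norm_zero]
    exact hε.le
  have heq : EqOn G 0 (halfSquare σ c r) := by
    obtain ⟨z₀, hz₀⟩ := halfSquare_nonempty hσ d (r := s / 4) (by positivity)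
    refine (hG.differentiableOn.analyticOnNhd
      (isOpen_halfSquare σ c r)).eqOn_zero_of_preconnected_of_eventuallyEq_zero
      (isPreconnected_halfSquare σ c r) (halfSquare_subset (by linarith) hz₀) ?_
    filter_upwards [(isOpen_halfSquare σ d (s / 4)).mem_nhds hz₀] with z hz
    exact hzero z (halfSquare_subset_closed _ _ _ hz)
  rw [← hG.eq_real x hx]
  have hcl : EqOn G 0 (closure (halfSquare σ c r)) :=
    heq.of_subset_closure (hG.continuousOn.mono (closure_halfSquare_subset σ c r))
      continuousOn_const subset_closure subset_rfl
  exact hcl (ofReal_mem_closure_halfSquare hσ hr hx)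

/-- The estimate applies to `G m - G n`, which is bounded by `M + M` and small on the real edge. -/
theorem uniformCauchySeqOn (hσ : σ ^ 2 = 1) (hr : 0 < r) {M : ℝ} {v : ℕ → ℝ → ℂ}
    {G : ℕ → ℂ → ℂ} (hG : ∀ n, IsHalfExtension σ c r (v n) (G n))
    (hM : ∀ n, ∀ z ∈ closedHalfSquare σ c r, ‖G n z‖ ≤ M)
    (hv : UniformCauchySeqOn v atTop {x | |x - c| ≤ r}) :
    UniformCauchySeqOn G atTop (closedHalfSquare σ c (r / 4)) := by
  rw [Metric.uniformCauchySeqOn_iff] at hv ⊢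
  intro δ hδ
  obtain ⟨ε, hε, hle⟩ := exists_norm_le_of_norm_le_real (M + M) hr (half_pos hδ)
  obtain ⟨N, hN⟩ := hv ε hε
  refine ⟨N, fun m hm n hn z hz => ?_⟩
  have hS := (hG m).sub (hG n)
  rw [dist_eq_norm]
  refine (hle hσ hS.continuousOn hS.differentiableOn (fun z hz => ?_) (fun x hx => ?_) z
    hz).trans_lt (half_lt_self hδ)
  · exact (norm_sub_le _ _).trans (add_le_add (hM m z hz) (hM n z hz))
  · rw [hS.eq_real x hx, Pi.sub_apply, ← dist_eq_norm]
    exact (hN m hm n hn x hx).le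

end IsHalfExtension

theorem exists_tendstoUniformlyOn {G : ℕ → ℂ → ℂ} {s : Set ℂ}
    (h : UniformCauchySeqOn G atTop s) : ∃ g : ℂ → ℂ, TendstoUniformlyOn G g atTop s := by
  have h1 : ∀ z, ∃ l, z ∈ s → Tendsto (fun n => G n z) atTop (𝓝 l) := by
    intro z
    by_cases hz : z ∈ s
    · obtain ⟨l, hl⟩ := cauchySeq_tendsto_of_complete (h.cauchySeq hz)
      exact ⟨l, fun _ => hl⟩
    · exact ⟨0, fun h => absurd h hz⟩
  choose g hg using h1
  exact ⟨g, h.tendstoUniformlyOn_of_tendsto fun z hz => hg z hz⟩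

/-- The half-extensions bounded by `M` pass to uniform limits on the real axis, at the price of
a smaller half-square. -/
theorem exists_isHalfExtension_of_tendsto {σ c r M : ℝ} (hσ : σ ^ 2 = 1) (hr : 0 < r)
    {v : ℕ → ℝ → ℂ} {v₀ : ℝ → ℂ} (hv : TendstoUniformlyOn v v₀ atTop {x | |x - c| ≤ r})
    (h : ∀ n, ∃ G, IsHalfExtension σ c r (v n) G ∧ ∀ z ∈ closedHalfSquare σ c r, ‖G z‖ ≤ M) :
    ∃ G, IsHalfExtension σ c (r / 4) v₀ G := by
  choose G hG hM using h
  obtain ⟨g, hg⟩ := exists_tendstoUniformlyOn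
    (IsHalfExtension.uniformCauchySeqOn hσ hr hG hM hv.uniformCauchySeqOn)
  have hG' := fun n => (hG n).mono (d := c) (s := r / 4) (by simp; linarith)
  refine ⟨g, hg.continuousOn (Frequently.of_forall fun n => (hG' n).continuousOn), ?_, ?_⟩
  · exact (hg.mono (halfSquare_subset_closed _ _ _)).tendstoLocallyUniformlyOn.differentiableOn
      (Eventually.of_forall fun n => (hG' n).differentiableOn) (isOpen_halfSquare _ _ _)
  · intro x hx
    refine tendsto_nhds_unique (hg.tendsto_at (ofReal_mem_closedHalfSquare hx)) ?_
    refine (hv.tendsto_at (x := x) ?_).congr fun n => ((hG' n).eq_real x hx).symm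
    show |x - c| ≤ r
    linarith

/-! ### Disc extensions and their limits. -/

/-- `f` is holomorphic on the disc `D(c, 2r)` and equal to `v` on `[c - r, c + r]`. -/
structure IsDiscExtension (c r : ℝ) (v : ℝ → ℂ) (f : ℂ → ℂ) : Prop where
  differentiableOn : DifferentiableOn ℂ f (Metric.ball (c : ℂ) (2 * r))
  eq_real : ∀ x : ℝ, |x - c| ≤ r → f x = v x

theorem IsDiscExtension.isHalfExtension {σ c r : ℝ} {v : ℝ → ℂ} {f : ℂ → ℂ} (hσ : σ ^ 2 = 1)
    (hr : 0 < r) (h : IsDiscExtension c r v f) : IsHalfExtension σ c r v f :=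
  ⟨h.differentiableOn.continuousOn.mono (closedHalfSquare_subset_ball hσ c hr),
    h.differentiableOn.mono ((halfSquare_subset_closed σ c r).trans
      (closedHalfSquare_subset_ball hσ c hr)), h.eq_real⟩

/-- The disc of radius `2 * (r / 8) = r / 4` lies in the union of the upper and lower half-squares
of size `r / 4`, so the one-sided estimates together give uniform convergence on it. -/
theorem exists_isDiscExtension_of_tendsto {c r M : ℝ} (hr : 0 < r)
    {v : ℕ → ℝ → ℂ} {v₀ : ℝ → ℂ} (hv : TendstoUniformlyOn v v₀ atTop {x | |x - c| ≤ r})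
    (h : ∀ n, ∃ f, IsDiscExtension c r (v n) f ∧
      ∀ z ∈ Metric.ball (c : ℂ) (2 * r), ‖f z‖ ≤ M) :
    ∃ f, IsDiscExtension c (r / 8) v₀ f := by
  choose G hG hM using h
  have hside : ∀ σ : ℝ, σ ^ 2 = 1 →
      UniformCauchySeqOn G atTop (closedHalfSquare σ c (r / 4)) := fun σ hσ =>
    IsHalfExtension.uniformCauchySeqOn hσ hr (fun n => (hG n).isHalfExtension hσ hr)
      (fun n z hz => hM n z (closedHalfSquare_subset_ball hσ c hr hz)) hv.uniformCauchySeqOn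
  have hUC : UniformCauchySeqOn G atTop (Metric.ball (c : ℂ) (2 * (r / 8))) := by
    intro s hs
    filter_upwards [hside 1 (by norm_num) s hs, hside (-1) (by norm_num) s hs] with m h1 h2 z hz
    rw [mem_ball_iff_norm] at hz
    have hre : |z.re - c| ≤ r / 4 := by
      have := Complex.abs_re_le_norm (z - c)
      simp only [Complex.sub_re, Complex.ofReal_re] at this
      linarith
    have him := Complex.abs_im_le_norm (z - c)
    simp only [Complex.sub_im, Complex.ofReal_im, sub_zero] at him
    obtain ⟨i1, i2⟩ := abs_le.1 him
    rcases le_total 0 z.im with hi | hi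
    · exact h1 z ⟨hre, by linarith, by linarith⟩
    · exact h2 z ⟨hre, by linarith, by linarith⟩
  obtain ⟨g, hg⟩ := exists_tendstoUniformlyOn hUC
  refine ⟨g, hg.tendstoLocallyUniformlyOn.differentiableOn (Eventually.of_forall fun n =>
    (hG n).differentiableOn.mono (Metric.ball_subset_ball (by linarith))) Metric.isOpen_ball, ?_⟩
  intro x hx
  have hx' : (x : ℂ) ∈ Metric.ball (c : ℂ) (2 * (r / 8)) := by
    rw [mem_ball_iff_norm, ← Complex.ofReal_sub, Complex.norm_real, Real.norm_eq_abs]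
    linarith
  refine tendsto_nhds_unique (hg.tendsto_at hx') ?_
  refine (hv.tendsto_at (x := x) ?_).congr fun n => ((hG n).eq_real x ?_).symm
  · show |x - c| ≤ r
    linarith
  · linarith

/-! ### A smooth function without half-extensions. -/

theorem exists_int_eq_of_sq_eq_one {σ : ℝ} (hσ : σ ^ 2 = 1) : ∃ m : ℤ, (m : ℝ) = σ := by
  rcases eq_or_eq_neg_of_sq_eq_sq σ 1 (by rw [hσ, one_pow]) with rfl | rfl
  · exact ⟨1, by simp⟩
  · exact ⟨-1, by simp⟩

/-- Reduces all half-extensions to countably many types: rational centre and size, and an integer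
bound obtained from compactness. -/
theorem IsHalfExtension.exists_rat {σ c r : ℝ} {v : ℝ → ℂ} {G : ℂ → ℂ} (hσ : σ ^ 2 = 1)
    (hr : 0 < r) (h : IsHalfExtension σ c r v G) :
    ∃ (d s : ℚ) (M : ℕ), 0 < (s : ℝ) ∧ |(d : ℝ) - c| + s ≤ r ∧ IsHalfExtension σ d s v G ∧
      ∀ z ∈ closedHalfSquare σ d s, ‖G z‖ ≤ M := by
  obtain ⟨d, hd1, hd2⟩ := exists_rat_btwn (show c - r / 2 < c + r / 2 by linarith)
  obtain ⟨s, hs1, hs2⟩ := exists_rat_btwn (show 0 < r / 2 by linarith)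
  have hds : |(d : ℝ) - c| + s ≤ r := by
    have : |(d : ℝ) - c| ≤ r / 2 := abs_le.2 ⟨by linarith, by linarith⟩
    linarith
  have h' := h.mono hds
  obtain ⟨M, hM⟩ : ∃ M, ∀ z ∈ closedHalfSquare σ d s, ‖G z‖ ≤ M :=
    (Metric.isCompact_of_isClosed_isBounded (isClosed_closedHalfSquare σ d s)
      (Metric.isBounded_ball.subset (closedHalfSquare_subset_ball hσ d hs1))).exists_bound_of_continuousOn
      h'.continuousOn
  obtain ⟨m, hm⟩ := exists_nat_ge M
  exact ⟨d, s, m, hs1, hds, h', fun z hz => (hM z hz).trans hm⟩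

/-- Compact support bounds each derivative, so a small multiple controls the first `n` of them; this
provides the coefficients of a smoothly convergent series. -/
theorem exists_pos_smul_iteratedFDeriv_le {f : ℝ → ℂ} (hf : ContDiff ℝ (⊤ : ℕ∞) f)
    (hs : HasCompactSupport f) (n : ℕ) {δ : ℝ} (hδ : 0 < δ) :
    ∃ a : ℝ, 0 < a ∧ ∀ k ≤ n, ∀ x, ‖iteratedFDeriv ℝ k (a • f) x‖ ≤ δ := by
  have h1 : ∀ k, ∃ C, ∀ x, ‖iteratedFDeriv ℝ k f x‖ ≤ C := fun k =>
    (hs.iteratedFDeriv k).exists_bound_of_continuous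
      (hf.continuous_iteratedFDeriv (by exact_mod_cast le_top))
  choose C hC using h1
  let D : ℝ := 1 + ∑ k ∈ Finset.range (n + 1), |C k|
  have hD : 0 < D := by positivity
  refine ⟨δ / D, by positivity, fun k hk x => ?_⟩
  rw [iteratedFDeriv_const_smul_apply (hf.contDiffAt.of_le (by exact_mod_cast le_top)), norm_smul,
    Real.norm_of_nonneg (by positivity)]
  have h2 : ‖iteratedFDeriv ℝ k f x‖ ≤ D := by
    have h3 := Finset.single_le_sum (f := fun k => |C k|) (fun i _ => abs_nonneg _)
      (Finset.mem_range.2 (Nat.lt_succ_of_le hk))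
    have h4 := hC k x
    have h5 := le_abs_self (C k)
    simp only [D]
    linarith
  calc δ / D * ‖iteratedFDeriv ℝ k f x‖ ≤ δ / D * D := by gcongr
    _ = δ := by field_simp

/-- Smooth functions of which each half-square sees one without half-extension. -/
theorem exists_seq_not_isHalfExtension :
    ∃ f : ℕ → ℝ → ℂ, (∀ n, ContDiff ℝ (⊤ : ℕ∞) (f n)) ∧ (∀ n, HasCompactSupport (f n)) ∧
      ∀ σ c r : ℝ, σ ^ 2 = 1 → 0 < r → ∃ n, ∀ G, ¬ IsHalfExtension σ c r (f n) G := by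
  have : Nonempty {p : ℚ × ℚ // 0 < p.2} := ⟨⟨(0, 1), one_pos⟩⟩
  obtain ⟨e, he⟩ := exists_surjective_nat {p : ℚ × ℚ // 0 < p.2}
  have hB : ∀ p : {p : ℚ × ℚ // 0 < p.2}, ∃ g : ℝ → ℂ, ContDiff ℝ (⊤ : ℕ∞) g ∧
      HasCompactSupport g ∧ g p.1.1 = 1 ∧ ∀ x : ℝ, (p.1.2 : ℝ) ≤ |x - p.1.1| → g x = 0 := by
    intro p
    have hp : (0 : ℝ) < p.1.2 := by exact_mod_cast p.2
    let B : ContDiffBump ((p.1.1 : ℚ) : ℝ) :=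
      ⟨(p.1.2 : ℝ) / 2, p.1.2, half_pos hp, half_lt_self hp⟩
    refine ⟨fun x => (B x : ℂ), Complex.ofRealCLM.contDiff.comp B.contDiff,
      B.hasCompactSupport.comp_left (g := ((↑) : ℝ → ℂ)) Complex.ofReal_zero, ?_, fun x hx => ?_⟩
    · beta_reduce
      rw [B.one_of_mem_closedBall (Metric.mem_closedBall_self B.rIn_pos.le), Complex.ofReal_one]
    · beta_reduce
      rw [B.zero_of_le_dist hx, Complex.ofReal_zero]
  choose g hg hgs hg1 hg0 using hB
  refine ⟨fun n => g (e n), fun n => hg _, fun n => hgs _, ?_⟩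
  intro σ c r hσ hr
  obtain ⟨q, hq1, hq2⟩ := exists_rat_btwn (show c - r / 4 < c + r / 4 by linarith)
  obtain ⟨s, hs1, hs2⟩ := exists_rat_btwn (show 0 < r / 4 by linarith)
  obtain ⟨n, hn⟩ := he ⟨(q, s), by exact_mod_cast hs1⟩
  refine ⟨n, fun G hG => ?_⟩
  beta_reduce at hG
  rw [hn] at hG
  have h1 := hg1 ⟨(q, s), by exact_mod_cast hs1⟩
  -- The segment is `[c + r/2, c + r]`. The bump vanishes there, since `q < c + r/4` and `s < r/4`,
  -- so uniqueness would give `0` at `q`, where the bump is `1`.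
  rw [hG.eq_zero hσ (d := c + 3 * r / 4) (s := r / 4) (by positivity)
    (by rw [abs_of_nonneg] <;> linarith) (fun x hx => ?_) (x := q)
    (abs_le.2 ⟨by linarith, by linarith⟩)] at h1
  · exact zero_ne_one h1
  · obtain ⟨hx1, hx2⟩ := abs_le.1 hx
    exact hg0 _ x (le_trans (by dsimp only; linarith) (le_abs_self _))

/-- Baire's theorem on bounded real sequences `t`, which parametrize the smooth functions `Φ t = ∑ t
n • a n • f n`. If every `Φ t` had a half-extension, some closure `S i` would contain a ball. Moving
one coordinate within the ball and subtracting would extend a nonzero multiple of `f n`, for an `n`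
chosen to make this impossible. -/
theorem exists_contDiff_not_isHalfExtension :
    ∃ v : ℝ → ℂ, ContDiff ℝ (⊤ : ℕ∞) v ∧
      ∀ σ c r : ℝ, σ ^ 2 = 1 → 0 < r → ∀ G, ¬ IsHalfExtension σ c r v G := by
  obtain ⟨f, hf, hfs, hne⟩ := exists_seq_not_isHalfExtension
  choose a ha hab using fun n => exists_pos_smul_iteratedFDeriv_le (hf n) (hfs n) n
    (δ := (1 / 2) ^ n) (by positivity)
  have hψ : ∀ n, ContDiff ℝ (⊤ : ℕ∞) (a n • f n) := fun n => (hf n).const_smul (a n)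
  have hψ0 : ∀ n x, ‖(a n • f n) x‖ ≤ (1 / 2) ^ n := fun n x => by
    simpa using hab n 0 (Nat.zero_le n) x
  let Φ : BoundedContinuousFunction ℕ ℝ → ℝ → ℂ := fun t x => ∑' n, t n • (a n • f n) x
  have hterm : ∀ (t : BoundedContinuousFunction ℕ ℝ) (n : ℕ) (x : ℝ),
      ‖t n • (a n • f n) x‖ ≤ ‖t‖ * (1 / 2) ^ n := fun t n x => by
    rw [norm_smul]
    exact mul_le_mul (t.norm_coe_le_norm n) (hψ0 n x) (norm_nonneg _) (norm_nonneg _)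
  have hgeo : ∀ t : BoundedContinuousFunction ℕ ℝ, Summable fun n : ℕ => ‖t‖ * (1 / 2 : ℝ) ^ n :=
    fun t => summable_geometric_two.mul_left _
  have hsum : ∀ (t : BoundedContinuousFunction ℕ ℝ) (x : ℝ), Summable fun n => t n • (a n • f n) x := fun t x =>
    Summable.of_norm_bounded (hgeo t) fun n => hterm t n x
  have hΦ : ∀ t, ContDiff ℝ (⊤ : ℕ∞) (Φ t) := fun t => by
    refine contDiff_tsum_of_eventually (v := fun _ n => ‖t‖ * (1 / 2) ^ n)
      (fun n => (hψ n).const_smul (t n)) (fun _ _ => hgeo t) fun k _ => ?_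
    -- The scaling controls the `k`-th derivative of the `n`-th term only for `n ≥ k`, that is, for
    -- all but finitely many `n`.
    rw [Nat.cofinite_eq_atTop]
    filter_upwards [eventually_ge_atTop k] with n hn x
    have : (fun x => t n • (a n • f n) x) = t n • (a n • f n) := rfl
    rw [this, iteratedFDeriv_const_smul_apply
      ((hψ n).contDiffAt.of_le (by exact_mod_cast le_top)), norm_smul]
    exact mul_le_mul (t.norm_coe_le_norm n) (hab n k hn x) (norm_nonneg _) (norm_nonneg _)
  have hΦsub : ∀ s t, Φ (s - t) = Φ s - Φ t := fun s t => by
    funext x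
    simp only [Φ, Pi.sub_apply]
    rw [← (hsum s x).tsum_sub (hsum t x)]
    exact tsum_congr fun n => by rw [BoundedContinuousFunction.sub_apply, sub_smul]
  have hΦle : ∀ t x, ‖Φ t x‖ ≤ ‖t‖ * 2 := fun t x => by
    refine (tsum_of_norm_bounded (hgeo t).hasSum (hterm t · x)).trans ?_
    rw [tsum_mul_left, tsum_geometric_two]
  let S : ℤ × ℚ × ℚ × ℕ → Set (BoundedContinuousFunction ℕ ℝ) := fun i =>
    {t | (i.1 : ℝ) ^ 2 = 1 ∧ (0 : ℝ) < i.2.2.1 ∧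
      ∃ G, IsHalfExtension i.1 i.2.1 i.2.2.1 (Φ t) G ∧
        ∀ z ∈ closedHalfSquare i.1 i.2.1 i.2.2.1, ‖G z‖ ≤ i.2.2.2}
  have hScl : ∀ i, ∀ t ∈ closure (S i), ∃ G, IsHalfExtension i.1 i.2.1 (i.2.2.1 / 4) (Φ t) G := by
    intro i t ht
    obtain ⟨s, hs, hst⟩ := mem_closure_iff_seq_limit.1 ht
    refine exists_isHalfExtension_of_tendsto (hs 0).1 (hs 0).2.1 (v := fun n => Φ (s n))
      ?_ fun n => (hs n).2.2
    rw [Metric.tendstoUniformlyOn_iff]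
    intro ε hε
    filter_upwards [(Metric.tendsto_nhds.1 hst) (ε / 2) (by positivity)] with n hn x _
    rw [dist_eq_norm, ← Pi.sub_apply, ← hΦsub]
    refine (hΦle _ x).trans_lt ?_
    rw [dist_comm, dist_eq_norm] at hn
    linarith
  by_contra! hcon
  have hcover : ⋃ i, closure (S i) = univ := by
    refine eq_univ_of_forall fun t => ?_
    obtain ⟨σ, c, r, hσ, hr, G, hG⟩ := hcon (Φ t) (hΦ t)
    obtain ⟨d, s, M, hs, -, hG', hM⟩ := hG.exists_rat hσ hr
    obtain ⟨m, rfl⟩ := exists_int_eq_of_sq_eq_one hσ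
    exact mem_iUnion.2 ⟨(m, d, s, M), subset_closure ⟨hσ, hs, G, hG', hM⟩⟩
  obtain ⟨i, t, ht⟩ := nonempty_interior_of_iUnion_of_closed (fun i => isClosed_closure) hcover
  obtain ⟨t', hσ, hr, -⟩ := closure_nonempty_iff.1 ⟨t, interior_subset ht⟩
  obtain ⟨ε, hε, hball⟩ := Metric.isOpen_iff.1 isOpen_interior t ht
  -- Elements of the closure extend only to the quarter-size half-square, so `f n` has to be
  -- non-extendable there.
  obtain ⟨n, hn⟩ := hne i.1 i.2.1 (i.2.2.1 / 4) hσ (by positivity)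
  let δ : BoundedContinuousFunction ℕ ℝ :=
    BoundedContinuousFunction.ofNormedAddCommGroupDiscrete (Pi.single n (ε / 2)) (ε / 2) fun m => by
      rcases eq_or_ne m n with rfl | h
      · rw [Pi.single_eq_same, Real.norm_of_nonneg (by positivity)]
      · rw [Pi.single_eq_of_ne h, norm_zero]; positivity
  have hδ : ‖δ‖ ≤ ε / 2 := BoundedContinuousFunction.norm_ofNormedAddCommGroup_le _ (by positivity) _
  have hδt : t + δ ∈ closure (S i) := by
    refine interior_subset (hball ?_)
    rw [mem_ball_iff_norm, add_sub_cancel_left]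
    linarith
  obtain ⟨G, hG⟩ := hScl i _ hδt
  obtain ⟨H, hH⟩ := hScl i t (interior_subset ht)
  have hGH := hG.sub hH
  rw [← hΦsub, add_sub_cancel_left] at hGH
  have hΦδ : Φ δ = ((ε / 2 * a n : ℝ) : ℂ) • f n := by
    funext x
    simp only [Φ]
    rw [tsum_eq_single n]
    · simp [δ, mul_assoc]
    · intro m hm
      simp [δ, hm]
  rw [hΦδ] at hGH
  have hne0 : ((ε / 2 * a n : ℝ) : ℂ) ≠ 0 := by
    have := ha n
    exact_mod_cast (by positivity : ε / 2 * a n ≠ 0)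
  have := hGH.const_smul ((ε / 2 * a n : ℝ) : ℂ)⁻¹
  rw [smul_smul, inv_mul_cancel₀ hne0, one_smul] at this
  exact hn _ this

/-! ### Injective holomorphic maps and their inverses. -/

section InjectiveHolomorphic

variable {V : Set ℂ} {F : ℂ → ℂ}

theorem abs_eq_one_of_sq_eq_one {σ : ℝ} (hσ : σ ^ 2 = 1) : |σ| = 1 := by
  rw [← abs_one, ← sq_eq_sq_iff_abs_eq_abs, hσ, one_pow]

theorem not_eventually_const (hi : InjOn F V) (hV : IsOpen V) {z : ℂ} (hz : z ∈ V) :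
    ¬ ∀ᶠ w in 𝓝 z, F w = F z := by
  intro h
  have h1 : ∀ᶠ w in 𝓝[≠] z, F w = F z ∧ w ∈ V ∧ w ≠ z :=
    (h.filter_mono nhdsWithin_le_nhds).and
      ((hV.eventually_mem hz).filter_mono nhdsWithin_le_nhds |>.and self_mem_nhdsWithin)
  obtain ⟨w, hw, hwV, hne⟩ := h1.exists
  exact hne (hi hwV hz hw)

theorem nhds_le_map_nhds (hV : IsOpen V) (hd : DifferentiableOn ℂ F V) (hi : InjOn F V) {z : ℂ}
    (hz : z ∈ V) : 𝓝 (F z) ≤ map F (𝓝 z) :=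
  ((hd.analyticAt (hV.mem_nhds hz)).eventually_constant_or_nhds_le_map_nhds).resolve_left
    (not_eventually_const hi hV hz)

theorem isOpen_image_of_injOn (hV : IsOpen V) (hd : DifferentiableOn ℂ F V) (hi : InjOn F V)
    {U : Set ℂ} (hU : IsOpen U) (hUV : U ⊆ V) : IsOpen (F '' U) := by
  rw [isOpen_iff_mem_nhds]
  rintro _ ⟨z, hz, rfl⟩
  exact nhds_le_map_nhds hV hd hi (hUV hz) (image_mem_map (hU.mem_nhds hz))

theorem eventually_deriv_ne_zero (hV : IsOpen V) (hd : DifferentiableOn ℂ F V) (hi : InjOn F V)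
    {z : ℂ} (hz : z ∈ V) : ∀ᶠ w in 𝓝[≠] z, deriv F w ≠ 0 := by
  refine ((hd.analyticAt (hV.mem_nhds hz)).deriv.eventually_eq_zero_or_eventually_ne_zero
    ).resolve_left fun h => not_eventually_const hi hV hz ?_
  obtain ⟨δ, hδ, hball⟩ := Metric.eventually_nhds_iff_ball.1 (h.and (hV.mem_nhds hz))
  filter_upwards [Metric.ball_mem_nhds z hδ] with w hw
  exact Metric.isOpen_ball.is_const_of_deriv_eq_zero (convex_ball z δ).isPreconnected
    (hd.mono fun y hy => (hball y hy).2) (fun y hy => (hball y hy).1) hw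
    (Metric.mem_ball_self hδ)

/-- The inverse of an injective holomorphic function is holomorphic. -/
theorem differentiableOn_leftInverse (hV : IsOpen V) (hd : DifferentiableOn ℂ F V)
    (hi : InjOn F V) {Φ : ℂ → ℂ} (hΦ : LeftInvOn Φ F V) : DifferentiableOn ℂ Φ (F '' V) := by
  have hcont : ∀ z ∈ V, ContinuousAt Φ (F z) := by
    intro z hz
    have h1 : Tendsto Φ (map F (𝓝 z)) (𝓝 z) := by
      rw [tendsto_map'_iff]
      refine tendsto_id.congr' ?_
      filter_upwards [hV.mem_nhds hz] with w hw
      exact (hΦ hw).symm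
    have h2 := h1.mono_left (nhds_le_map_nhds hV hd hi hz)
    rwa [ContinuousAt, hΦ hz]
  have hopen : IsOpen (F '' V) := isOpen_image_of_injOn hV hd hi hV subset_rfl
  have hright : ∀ w ∈ F '' V, F (Φ w) = w ∧ Φ w ∈ V := by
    rintro _ ⟨z, hz, rfl⟩
    rw [hΦ hz]
    exact ⟨rfl, hz⟩
  rintro _ ⟨z, hz, rfl⟩
  -- Zeros of `F'` are isolated, so `Φ` is differentiable on a punctured neighbourhood of `F z`;
  -- continuity at `F z` removes the singularity. That `F'` has no zeros at all is never needed.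
  refine (Complex.analyticAt_of_differentiable_on_punctured_nhds_of_continuousAt ?_
    (hcont z hz)).differentiableAt.differentiableWithinAt
  have hne : Tendsto Φ (𝓝[≠] (F z)) (𝓝[≠] z) := by
    refine tendsto_nhdsWithin_iff.2 ⟨?_, ?_⟩
    · have := (hcont z hz).tendsto
      rw [hΦ hz] at this
      exact this.mono_left nhdsWithin_le_nhds
    · filter_upwards [self_mem_nhdsWithin,
        (hopen.eventually_mem (mem_image_of_mem F hz)).filter_mono nhdsWithin_le_nhds] with w hw hwV h
      rw [mem_singleton_iff] at h
      apply hw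
      rw [mem_singleton_iff, ← h, (hright w hwV).1]
  filter_upwards [hne.eventually (eventually_deriv_ne_zero hV hd hi hz),
    (hopen.eventually_mem (mem_image_of_mem F hz)).filter_mono nhdsWithin_le_nhds] with w hw hwV
  obtain ⟨h1, h2⟩ := hright w hwV
  have hcw := hcont _ h2
  rw [h1] at hcw
  refine (HasDerivAt.of_local_left_inverse hcw
    (hd.differentiableAt (hV.mem_nhds h2)).hasDerivAt hw ?_).differentiableAt
  filter_upwards [hopen.mem_nhds hwV] with y hy using (hright y hy).1

end InjectiveHolomorphic

/-! ### Transfer between the arc and the real line. -/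

/-- The side `0 < σ * Im z` of the curve. -/
def side (σ : ℝ) (V : Set ℂ) (F : ℂ → ℂ) : Set ℂ := F '' ({z | 0 < σ * z.im} ∩ V)

theorem side_one (V : Set ℂ) (F : ℂ → ℂ) : side 1 V F = sidePlus V F := by
  simp [side, sidePlus]

theorem side_neg_one (V : Set ℂ) (F : ℂ → ℂ) : side (-1) V F = sideMinus V F := by
  simp [side, sideMinus]

/-- Since `t` may be an endpoint of `[a, b]`, the centre is moved to a nearby interior point. -/
theorem exists_segment {a b : ℝ} (hab : a < b) {t : ℝ} (ht : t ∈ Icc a b) {N : Set ℂ}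
    (hN : N ∈ 𝓝 (t : ℂ)) : ∃ c r : ℝ, 0 < r ∧ (∀ x, |x - c| ≤ r → x ∈ Icc a b) ∧
      Metric.ball (c : ℂ) (2 * r) ⊆ N := by
  obtain ⟨δ, hδ, hball⟩ := Metric.mem_nhds_iff.1 hN
  obtain ⟨c, hc1, hc2⟩ := exists_between (show max a (t - δ / 2) < min b (t + δ / 2) by
    refine max_lt (lt_min hab ?_) (lt_min ?_ ?_) <;> linarith [ht.1, ht.2])
  rw [max_lt_iff] at hc1
  rw [lt_min_iff] at hc2
  refine ⟨c, min (min (c - a) (b - c)) (δ / 4), ?_, fun x hx => ?_, fun z hz => hball ?_⟩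
  · refine lt_min (lt_min ?_ ?_) ?_ <;> linarith
  · obtain ⟨h1, h2⟩ := abs_le.1 hx
    have h3 : min (min (c - a) (b - c)) (δ / 4) ≤ c - a := (min_le_left _ _).trans (min_le_left _ _)
    have h4 : min (min (c - a) (b - c)) (δ / 4) ≤ b - c := (min_le_left _ _).trans (min_le_right _ _)
    exact ⟨by linarith, by linarith⟩
  · have h1 : dist (c : ℂ) t < δ / 2 := by
      rw [dist_eq_norm, ← Complex.ofReal_sub, Complex.norm_real, Real.norm_eq_abs, abs_lt]
      constructor <;> linarith
    have h2 := min_le_right (min (c - a) (b - c)) (δ / 4)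
    rw [Metric.mem_ball] at hz ⊢
    linarith [dist_triangle z c t]

variable {a b : ℝ} {γ : Icc a b → ℂ} {V : Set ℂ} {F : ℂ → ℂ}

theorem pullback_of_mem (hab : a < b) (u : range γ → ℂ) {x : ℝ} (hx : x ∈ Icc a b) :
    pullback hab γ u x = u ⟨γ ⟨x, hx⟩, mem_range_self _⟩ :=
  IccExtend_of_mem hab.le _ hx

namespace IsAnalyticExtension

theorem continuous_curve (hF : IsAnalyticExtension γ V F) : Continuous γ := by
  have : γ = fun t : Icc a b => F ((t : ℝ) : ℂ) := funext fun t => (hF.eq_curve t).symm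
  rw [this]
  exact hF.holomorphic.continuousOn.comp_continuous (by fun_prop) hF.mem

theorem injective_curve (hF : IsAnalyticExtension γ V F) : Function.Injective γ := by
  intro s t h
  rw [← hF.eq_curve, ← hF.eq_curve] at h
  exact Subtype.ext (Complex.ofReal_injective (hF.injective (hF.mem s) (hF.mem t) h))

theorem eq_of_mem (hF : IsAnalyticExtension γ V F) {x : ℝ} (hx : x ∈ Icc a b) :
    F x = γ ⟨x, hx⟩ := hF.eq_curve ⟨x, hx⟩

theorem continuousAt (hF : IsAnalyticExtension γ V F) {z : ℂ} (hz : z ∈ V) : ContinuousAt F z :=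
  hF.holomorphic.continuousOn.continuousAt (hF.isOpen.mem_nhds hz)

/-- A function on the arc is continuous as soon as its pullback is. -/
theorem continuous_of_pullback (hF : IsAnalyticExtension γ V F) {hab : a < b} {u : range γ → ℂ}
    (hu : ContinuousOn (pullback hab γ u) (Icc a b)) : Continuous u := by
  -- A continuous map from a compact space to a Hausdorff one is closed, so `γ` is a quotient map
  -- onto its trace.
  have hc : Continuous (rangeFactorization γ) := hF.continuous_curve.subtype_mk _
  refine (hc.isClosedMap.isQuotientMap hc rangeFactorization_surjective).continuous_iff.2 ?_
  have := continuousOn_iff_continuous_domRestrict.1 hu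
  refine this.congr fun t => ?_
  exact pullback_of_mem hab u t.2

/-- The half-extension is `g ∘ F`: near a parameter of a point of `W`, `F` sends the real segment
into `γ*` and the open half-square into `W ∩ K`. -/
theorem exists_isHalfExtension (hF : IsAnalyticExtension γ V F) (hab : a < b) {σ : ℝ}
    (hσ : σ ^ 2 = 1) {u : range γ → ℂ} (hu : ExtendableFromSide γ (side σ V F) u) :
    ∃ c r : ℝ, 0 < r ∧ (∀ x, |x - c| ≤ r → x ∈ Icc a b) ∧ Metric.ball (c : ℂ) (2 * r) ⊆ V ∧
      ∃ G, IsHalfExtension σ c r (pullback hab γ u) G := by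
  obtain ⟨W, hWo, -, ⟨_, hW, t, rfl⟩, g, hgc, hgd, hgu⟩ := hu
  have hN : F ⁻¹' W ∩ V ∈ 𝓝 ((t : ℝ) : ℂ) := by
    refine inter_mem ((hF.continuousAt (hF.mem t)).preimage_mem_nhds ?_)
      (hF.isOpen.mem_nhds (hF.mem t))
    rw [hF.eq_curve]
    exact hWo.mem_nhds hW
  obtain ⟨c, r, hr, hI, hball⟩ := exists_segment hab t.2 hN
  have hsub := (closedHalfSquare_subset_ball hσ c hr).trans hball
  refine ⟨c, r, hr, hI, fun z hz => (hball hz).2, g ∘ F, ?_, ?_, fun x hx => ?_⟩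
  · refine hgc.comp (hF.holomorphic.continuousOn.mono fun z hz => (hsub hz).2) fun z hz => ?_
    rcases hz.2.1.eq_or_lt with h | h
    · left
      have him : z.im = 0 := by
        rcases mul_eq_zero.1 h.symm with h | h
        · simp [h] at hσ
        · exact h
      rw [eq_ofReal_of_im_eq_zero him, hF.eq_of_mem (hI _ hz.1)]
      exact mem_range_self _
    · exact Or.inr ⟨(hsub hz).1, mem_image_of_mem F ⟨h, (hsub hz).2⟩⟩
  · have hs := (halfSquare_subset_closed σ c r).trans hsub
    exact hgd.comp (hF.holomorphic.mono fun z hz => (hs hz).2)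
      fun z hz => ⟨(hs hz).1, mem_image_of_mem F ⟨hz.2.1, (hs hz).2⟩⟩
  · have hxW := (hsub (ofReal_mem_closedHalfSquare hx)).1
    rw [mem_preimage, hF.eq_of_mem (hI x hx)] at hxW
    rw [Function.comp_apply, hF.eq_of_mem (hI x hx), pullback_of_mem hab u (hI x hx)]
    exact hgu ⟨_, mem_range_self _⟩ hxW

theorem exists_isDiscExtension (hF : IsAnalyticExtension γ V F) (hab : a < b)
    {u : range γ → ℂ} (hu : ExtendableToDisc γ u) :
    ∃ c r : ℝ, 0 < r ∧ (∀ x, |x - c| ≤ r → x ∈ Icc a b) ∧ Metric.ball (c : ℂ) (2 * r) ⊆ V ∧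
      ∃ f, IsDiscExtension c r (pullback hab γ u) f := by
  obtain ⟨_, ⟨t, rfl⟩, ρ, hρ, f, hfd, hfu⟩ := hu
  have hN : F ⁻¹' Metric.ball (γ t) ρ ∩ V ∈ 𝓝 ((t : ℝ) : ℂ) := by
    refine inter_mem ((hF.continuousAt (hF.mem t)).preimage_mem_nhds ?_)
      (hF.isOpen.mem_nhds (hF.mem t))
    rw [hF.eq_curve]
    exact Metric.ball_mem_nhds _ hρ
  obtain ⟨c, r, hr, hI, hball⟩ := exists_segment hab t.2 hN
  refine ⟨c, r, hr, hI, fun z hz => (hball hz).2, f ∘ F, ?_, fun x hx => ?_⟩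
  · exact hfd.comp (hF.holomorphic.mono fun z hz => (hball hz).2) fun z hz => (hball hz).1
  · have hxW := (hball (closedHalfSquare_subset_ball (σ := 1) (by norm_num) c hr
      (ofReal_mem_closedHalfSquare hx))).1
    rw [mem_preimage, hF.eq_of_mem (hI x hx)] at hxW
    rw [Function.comp_apply, hF.eq_of_mem (hI x hx), pullback_of_mem hab u (hI x hx)]
    exact hfu ⟨_, mem_range_self _⟩ hxW

theorem exists_leftInverse (hF : IsAnalyticExtension γ V F) :
    ∃ Φ : ℂ → ℂ, LeftInvOn Φ F V ∧ DifferentiableOn ℂ Φ (F '' V) :=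
  ⟨Function.invFunOn F V, hF.injective.leftInvOn_invFunOn,
    differentiableOn_leftInverse hF.isOpen hF.holomorphic hF.injective
      hF.injective.leftInvOn_invFunOn⟩

/-- The extension is `f ∘ Φ` on a disc inside `F '' ball c r`. By injectivity of `F`, the arc meets
this disc only at parameters within `r` of `c`, where `f` agrees with the pullback. -/
theorem extendableToDisc (hF : IsAnalyticExtension γ V F) {hab : a < b} {u : range γ → ℂ}
    {c r : ℝ} (hr : 0 < r) (hI : ∀ x, |x - c| ≤ r → x ∈ Icc a b)
    (hV : Metric.ball (c : ℂ) (2 * r) ⊆ V) {f : ℂ → ℂ}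
    (hf : IsDiscExtension c r (pullback hab γ u) f) : ExtendableToDisc γ u := by
  obtain ⟨Φ, hΦ, hΦd⟩ := hF.exists_leftInverse
  have hrV : Metric.ball (c : ℂ) r ⊆ V := (Metric.ball_subset_ball (by linarith)).trans hV
  have hO : IsOpen (F '' Metric.ball (c : ℂ) r) :=
    isOpen_image_of_injOn hF.isOpen hF.holomorphic hF.injective Metric.isOpen_ball hrV
  obtain ⟨ρ, hρ, hball⟩ := Metric.isOpen_iff.1 hO _
    (mem_image_of_mem F (Metric.mem_ball_self hr))
  have hc : c ∈ Icc a b := hI c (by simpa using hr.le)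
  refine ⟨F c, ?_, ρ, hρ, f ∘ Φ, ?_, ?_⟩
  · rw [hF.eq_of_mem hc]
    exact mem_range_self _
  · refine hf.differentiableOn.comp (hΦd.mono (hball.trans (image_mono hrV))) fun w hw => ?_
    obtain ⟨z, hz, rfl⟩ := hball hw
    rw [hΦ (hrV hz)]
    exact Metric.ball_subset_ball (by linarith) hz
  · rintro ⟨_, t, rfl⟩ hw
    obtain ⟨z, hz, hzt⟩ := hball hw
    simp only at hzt hw ⊢
    rw [← hF.eq_curve] at hzt
    have := hF.injective (hrV hz) (hF.mem t) hzt
    subst this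
    have htc : |(t : ℝ) - c| ≤ r := by
      rw [mem_ball_iff_norm, ← Complex.ofReal_sub, Complex.norm_real, Real.norm_eq_abs] at hz
      exact hz.le
    have hΦt : Φ (γ t) = ((t : ℝ) : ℂ) := by rw [← hF.eq_curve, hΦ (hF.mem t)]
    rw [Function.comp_apply, hΦt, hf.eq_real _ htc, pullback_of_mem hab u t.2]

-- The extension must be continuous on all of `γ*`, not only near `W`. Hence `G ∘ Φ` on the image of
-- the disc of radius `r` is glued to `u` elsewhere, with the smaller domain `W = F '' ball c (r /
-- 2)`; the two pieces agree on the arc.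
open Classical in
theorem extendableFromSide (hF : IsAnalyticExtension γ V F) {hab : a < b} {σ : ℝ}
    (hσ : σ ^ 2 = 1) {u : range γ → ℂ} (hu : Continuous u) {c r : ℝ} (hr : 0 < r)
    (hI : ∀ x, |x - c| ≤ r → x ∈ Icc a b) (hV : Metric.ball (c : ℂ) (2 * r) ⊆ V) {G : ℂ → ℂ}
    (hG : IsHalfExtension σ c r (pullback hab γ u) G) :
    ExtendableFromSide γ (side σ V F) u := by
  obtain ⟨Φ, hΦ, hΦd⟩ := hF.exists_leftInverse
  have hrV : Metric.ball (c : ℂ) r ⊆ V := (Metric.ball_subset_ball (by linarith)).trans hV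
  have hr2 : Metric.ball (c : ℂ) (r / 2) ⊆ Metric.ball (c : ℂ) r :=
    Metric.ball_subset_ball (by linarith)
  have himg : ∀ {U : Set ℂ}, IsOpen U → U ⊆ V → IsOpen (F '' U) := fun hU hUV =>
    isOpen_image_of_injOn hF.isOpen hF.holomorphic hF.injective hU hUV
  have hO : IsOpen (F '' Metric.ball (c : ℂ) r) := himg Metric.isOpen_ball hrV
  have hWO : F '' Metric.ball (c : ℂ) (r / 2) ⊆ F '' Metric.ball (c : ℂ) r := image_mono hr2
  have hc : c ∈ Icc a b := hI c (by simpa using hr.le)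
  let e : ℂ → ℂ := fun w => if h : w ∈ range γ then u ⟨w, h⟩ else 0
  have he : ∀ w : range γ, e w = u w := fun w => dif_pos w.2
  have hec : ContinuousOn e (range γ) := by
    rw [continuousOn_iff_continuous_domRestrict]
    exact hu.congr fun w => (he w).symm
  let g : ℂ → ℂ := fun w => if w ∈ F '' Metric.ball (c : ℂ) r then G (Φ w) else e w
  have hgO : EqOn g (G ∘ Φ) (F '' Metric.ball (c : ℂ) r) := fun w hw => if_pos hw
  have hcurve : ∀ t : Icc a b, γ t ∈ F '' Metric.ball (c : ℂ) r → |(t : ℝ) - c| ≤ r := by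
    rintro t ⟨z, hz, hzt⟩
    rw [← hF.eq_curve] at hzt
    rw [hF.injective (hrV hz) (hF.mem t) hzt, mem_ball_iff_norm, ← Complex.ofReal_sub,
      Complex.norm_real, Real.norm_eq_abs] at hz
    exact hz.le
  have hge : EqOn g e (range γ) := by
    rintro _ ⟨t, rfl⟩
    by_cases h : γ t ∈ F '' Metric.ball (c : ℂ) r
    · have hΦt : Φ (γ t) = ((t : ℝ) : ℂ) := by rw [← hF.eq_curve, hΦ (hF.mem t)]
      rw [hgO h, Function.comp_apply, he ⟨γ t, mem_range_self t⟩, hΦt,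
        hG.eq_real _ (hcurve t h), pullback_of_mem hab u t.2]
    · exact if_neg h
  have hhalf : ∀ w ∈ F '' Metric.ball (c : ℂ) (r / 2) ∩ side σ V F, Φ w ∈ halfSquare σ c r := by
    rintro _ ⟨⟨z, hz, rfl⟩, y, ⟨hy, hyV⟩, hyz⟩
    have hzV := hrV (hr2 hz)
    obtain rfl := hF.injective hyV hzV hyz
    rw [hΦ hzV]
    rw [mem_ball_iff_norm] at hz
    have h1 := Complex.abs_re_le_norm (y - c)
    have h2 := Complex.abs_im_le_norm (y - c)
    simp only [Complex.sub_re, Complex.ofReal_re, Complex.sub_im, Complex.ofReal_im,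
      sub_zero] at h1 h2
    have h3 : σ * y.im ≤ |y.im| := by
      refine (le_abs_self _).trans_eq ?_
      rw [abs_mul, abs_eq_one_of_sq_eq_one hσ, one_mul]
    exact ⟨by linarith, hy, by linarith⟩
  refine ⟨F '' Metric.ball (c : ℂ) (r / 2), himg Metric.isOpen_ball (hr2.trans hrV), ?_, ?_, g,
    ?_, ?_, fun z _ => (hge z.2).trans (he z)⟩
  · exact (Metric.isConnected_ball (by positivity)).image F
      (hF.holomorphic.continuousOn.mono (hr2.trans hrV))
  · refine ⟨F c, mem_image_of_mem F (Metric.mem_ball_self (by positivity)), ?_⟩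
    rw [hF.eq_of_mem hc]
    exact mem_range_self _
  · intro w hw
    by_cases hwO : w ∈ F '' Metric.ball (c : ℂ) r
    · rw [← continuousWithinAt_inter (hO.mem_nhds hwO)]
      have hmaps : MapsTo Φ ((range γ ∪ F '' Metric.ball (c : ℂ) (r / 2) ∩ side σ V F) ∩
          F '' Metric.ball (c : ℂ) r) (closedHalfSquare σ c r) := by
        rintro y ⟨⟨t, rfl⟩ | hy, hyO⟩
        · rw [← hF.eq_curve, hΦ (hF.mem t)]
          exact ofReal_mem_closedHalfSquare (hcurve t hyO)
        · exact halfSquare_subset_closed _ _ _ (hhalf y hy)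
      have hcomp : ContinuousOn (G ∘ Φ) ((range γ ∪ F '' Metric.ball (c : ℂ) (r / 2) ∩
          side σ V F) ∩ F '' Metric.ball (c : ℂ) r) :=
        hG.continuousOn.comp (hΦd.continuousOn.mono (inter_subset_right.trans (image_mono hrV)))
          hmaps
      exact (hcomp.congr fun y hy => hgO hy.2) w ⟨hw, hwO⟩
    -- Away from the image of the closed disc of radius `r / 2`, the set on which continuity is
    -- required reduces to the arc itself, where `g` agrees with the continuous `e`.
    · have hC : IsClosed (F '' Metric.closedBall (c : ℂ) (r / 2)) := by
        refine ((isCompact_closedBall _ _).image_of_continuousOn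
          (hF.holomorphic.continuousOn.mono ?_)).isClosed
        exact (Metric.closedBall_subset_ball (by linarith)).trans hrV
      have hwC : w ∉ F '' Metric.closedBall (c : ℂ) (r / 2) := fun h =>
        hwO (image_mono (Metric.closedBall_subset_ball (by linarith)) h)
      rw [← continuousWithinAt_inter (hC.isOpen_compl.mem_nhds hwC)]
      have hsub : (range γ ∪ F '' Metric.ball (c : ℂ) (r / 2) ∩ side σ V F) ∩
          (F '' Metric.closedBall (c : ℂ) (r / 2))ᶜ ⊆ range γ := by
        rintro y ⟨hy | hy, hyC⟩
        · exact hy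
        · exact absurd (image_mono Metric.ball_subset_closedBall hy.1) hyC
      exact ((hec.mono hsub).congr fun y hy => hge (hsub hy)) w ⟨hw, hwC⟩
  · refine (hG.differentiableOn.comp (hΦd.mono ?_) hhalf).congr fun w hw => hgO (hWO hw.1)
    exact inter_subset_left.trans (image_mono (hr2.trans hrV))

end IsAnalyticExtension

theorem ball_subset_ball_of_add_le {c r d s : ℝ} (hs : s ≤ r) (h : |d - c| + s ≤ r) :
    Metric.ball (d : ℂ) (2 * s) ⊆ Metric.ball (c : ℂ) (2 * r) := by
  refine Metric.ball_subset_ball' ?_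
  rw [dist_eq_norm, ← Complex.ofReal_sub, Complex.norm_real, Real.norm_eq_abs]
  linarith

theorem IsDiscExtension.exists_rat {c r : ℝ} {v : ℝ → ℂ} {f : ℂ → ℂ} (hr : 0 < r)
    (h : IsDiscExtension c r v f) :
    ∃ (d s : ℚ) (M : ℕ), 0 < (s : ℝ) ∧ |(d : ℝ) - c| + s ≤ r ∧ IsDiscExtension d s v f ∧
      ∀ z ∈ Metric.ball ((d : ℝ) : ℂ) (2 * s), ‖f z‖ ≤ M := by
  obtain ⟨d, hd1, hd2⟩ := exists_rat_btwn (show c - r / 2 < c + r / 2 by linarith)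
  obtain ⟨s, hs1, hs2⟩ := exists_rat_btwn (show 0 < r / 2 by linarith)
  have hd : |(d : ℝ) - c| ≤ r / 2 := abs_le.2 ⟨by linarith, by linarith⟩
  have hds : |(d : ℝ) - c| + s ≤ r := by linarith
  have hsub : Metric.closedBall ((d : ℝ) : ℂ) (2 * s) ⊆ Metric.ball (c : ℂ) (2 * r) := by
    refine Metric.closedBall_subset_ball' ?_
    rw [dist_eq_norm, ← Complex.ofReal_sub, Complex.norm_real, Real.norm_eq_abs]
    linarith
  obtain ⟨M, hM⟩ := (isCompact_closedBall ((d : ℝ) : ℂ) (2 * s)).exists_bound_of_continuousOn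
    (h.differentiableOn.continuousOn.mono hsub)
  obtain ⟨m, hm⟩ := exists_nat_ge M
  refine ⟨d, s, m, hs1, hds, ⟨h.differentiableOn.mono (Metric.ball_subset_closedBall.trans hsub),
    fun x hx => h.eq_real x ?_⟩, fun z hz => (hM z (Metric.ball_subset_closedBall hz)).trans hm⟩
  linarith [abs_sub_le x d c]

/-! ### The topology of `C^k(γ*)` and the G_δ property. -/

variable {hab : a < b} {k : ℕ∞}

theorem Ck.withSeminorms : WithSeminorms (Ck.seminorms hab γ k) := ⟨rfl⟩

instance : Nonempty {l : ℕ // (l : ℕ∞) ≤ k} := ⟨⟨0, by simp⟩⟩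

instance : IsTopologicalAddGroup (Ck hab γ k) := Ck.withSeminorms.topologicalAddGroup

instance : ContinuousSMul ℂ (Ck hab γ k) := Ck.withSeminorms.continuousSMul

/-- The map `u ↦ u ∘ γ` into the continuous functions on `[a, b]`. -/
noncomputable def Ck.compCurve : Ck hab γ k →ₗ[ℂ] C(Icc a b, ℂ) := Ck.derivMap ⟨0, by simp⟩

theorem Ck.continuous_compCurve : Continuous (Ck.compCurve (hab := hab) (γ := γ) (k := k)) := by
  refine WithSeminorms.continuous_normedSpace_rng _ Ck.withSeminorms _
    ⟨{⟨0, by simp⟩}, 1, ?_⟩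
  rw [Finset.sup_singleton, one_smul]
  exact le_rfl

theorem Ck.IccExtend_compCurve (u : Ck hab γ k) :
    IccExtend hab.le (Ck.compCurve u) = pullback hab γ u.toFun := by
  unfold pullback
  congr 1
  funext t
  show iteratedDerivWithin 0 (pullback hab γ u.toFun) (Icc a b) t = _
  rw [iteratedDerivWithin_zero, pullback_of_mem hab _ t.2]

theorem Ck.continuous_toFun (hF : IsAnalyticExtension γ V F) (u : Ck hab γ k) :
    Continuous u.toFun :=
  hF.continuous_of_pullback u.contDiffOn.continuousOn

theorem pullback_add_smul (u v : Ck hab γ k) (c : ℂ) :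
    pullback hab γ (u + c • v).toFun = pullback hab γ u.toFun + c • pullback hab γ v.toFun := rfl

/-- The sets `T i` need not be closed: it suffices that their uniform closures pull back into `E`,
since `E` is then the union of these closed preimages. The topology of `C^k(γ*)` enters only through
continuity of `Ck.compCurve`. -/
theorem isGδ_compl_of_closure {ι : Type*} [Countable ι] {E : Set (Ck hab γ k)}
    (T : ι → Set C(Icc a b, ℂ)) (h₁ : ∀ u ∈ E, ∃ i, Ck.compCurve u ∈ T i)
    (h₂ : ∀ i u, Ck.compCurve u ∈ closure (T i) → u ∈ E) : IsGδ Eᶜ := by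
  have : E = ⋃ i, Ck.compCurve ⁻¹' closure (T i) := by
    ext u
    simp only [mem_iUnion, mem_preimage]
    exact ⟨fun hu => (h₁ u hu).imp fun i hi => subset_closure hi, fun ⟨i, hi⟩ => h₂ i u hi⟩
  rw [this, compl_iUnion]
  exact IsGδ.iInter_of_isOpen fun i =>
    (isClosed_closure.preimage Ck.continuous_compCurve).isOpen_compl

theorem tendstoUniformlyOn_IccExtend (hab : a < b) {w : ℕ → C(Icc a b, ℂ)} {w₀ : C(Icc a b, ℂ)}
    (h : Tendsto w atTop (𝓝 w₀)) (s : Set ℝ) :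
    TendstoUniformlyOn (fun n => IccExtend hab.le (w n)) (IccExtend hab.le w₀) atTop s :=
  ((ContinuousMap.tendsto_iff_tendstoUniformly.1 h).comp (projIcc a b hab.le)).tendstoUniformlyOn

theorem isGδ_not_extendableFromSide (hF : IsAnalyticExtension γ V F) {σ : ℝ} (hσ : σ ^ 2 = 1) :
    IsGδ {u : Ck hab γ k | ¬ ExtendableFromSide γ (side σ V F) u.toFun} := by
  refine isGδ_compl_of_closure (E := {u | ExtendableFromSide γ (side σ V F) u.toFun})
    (fun i : ℚ × ℚ × ℕ => {w | (0 < (i.2.1 : ℝ) ∧ (∀ x : ℝ, |x - i.1| ≤ i.2.1 → x ∈ Icc a b) ∧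
      Metric.ball ((i.1 : ℝ) : ℂ) (2 * i.2.1) ⊆ V) ∧
      ∃ G, IsHalfExtension σ i.1 i.2.1 (IccExtend hab.le w) G ∧
        ∀ z ∈ closedHalfSquare σ i.1 i.2.1, ‖G z‖ ≤ i.2.2}) ?_ ?_
  · intro u hu
    obtain ⟨c, r, hr, hI, hV, G, hG⟩ := hF.exists_isHalfExtension hab hσ hu
    obtain ⟨d, s, M, hs, hds, hG', hM⟩ := hG.exists_rat hσ hr
    refine ⟨(d, s, M), ⟨hs, fun x hx => hI x ?_, (ball_subset_ball_of_add_le ?_ hds).trans hV⟩, G,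
      ?_, hM⟩
    · exact (abs_sub_le x d c).trans (by linarith)
    · linarith [abs_nonneg ((d : ℝ) - c)]
    · rwa [Ck.IccExtend_compCurve]
  · intro i u hu
    obtain ⟨w, hw, hwu⟩ := mem_closure_iff_seq_limit.1 hu
    -- The conditions on the segment and the disc do not involve `w`, so any term of the sequence
    -- supplies them.
    obtain ⟨hr, hI, hV⟩ := (hw 0).1
    obtain ⟨G, hG⟩ := exists_isHalfExtension_of_tendsto hσ hr
      (tendstoUniformlyOn_IccExtend hab hwu _) fun n => (hw n).2
    rw [Ck.IccExtend_compCurve] at hG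
    exact hF.extendableFromSide hσ (u.continuous_toFun hF) (by positivity)
      (fun x hx => hI x (by linarith))
      ((Metric.ball_subset_ball (by linarith)).trans hV) hG

theorem isGδ_not_extendableToDisc (hF : IsAnalyticExtension γ V F) :
    IsGδ {u : Ck hab γ k | ¬ ExtendableToDisc γ u.toFun} := by
  refine isGδ_compl_of_closure (E := {u | ExtendableToDisc γ u.toFun})
    (fun i : ℚ × ℚ × ℕ => {w | (0 < (i.2.1 : ℝ) ∧ (∀ x : ℝ, |x - i.1| ≤ i.2.1 → x ∈ Icc a b) ∧
      Metric.ball ((i.1 : ℝ) : ℂ) (2 * i.2.1) ⊆ V) ∧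
      ∃ f, IsDiscExtension i.1 i.2.1 (IccExtend hab.le w) f ∧
        ∀ z ∈ Metric.ball ((i.1 : ℝ) : ℂ) (2 * i.2.1), ‖f z‖ ≤ i.2.2}) ?_ ?_
  · intro u hu
    obtain ⟨c, r, hr, hI, hV, f, hf⟩ := hF.exists_isDiscExtension hab hu
    obtain ⟨d, s, M, hs, hds, hf', hM⟩ := hf.exists_rat hr
    refine ⟨(d, s, M), ⟨hs, fun x hx => hI x ?_, (ball_subset_ball_of_add_le ?_ hds).trans hV⟩, f,
      ?_, hM⟩
    · exact (abs_sub_le x d c).trans (by linarith)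
    · linarith [abs_nonneg ((d : ℝ) - c)]
    · rwa [Ck.IccExtend_compCurve]
  · intro i u hu
    obtain ⟨w, hw, hwu⟩ := mem_closure_iff_seq_limit.1 hu
    obtain ⟨hr, hI, hV⟩ := (hw 0).1
    obtain ⟨f, hf⟩ := exists_isDiscExtension_of_tendsto hr
      (tendstoUniformlyOn_IccExtend hab hwu _) fun n => (hw n).2
    rw [Ck.IccExtend_compCurve] at hf
    exact hF.extendableToDisc (by positivity) (fun x hx => hI x (by linarith))
      ((Metric.ball_subset_ball (by linarith)).trans hV) hf

/-! ### Density of the functions without half-extensions. -/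

/-- The functions without half-extension over any segment inside `[a, b]`, on either side. -/
def nowhereExtendable (hab : a < b) (γ : Icc a b → ℂ) (k : ℕ∞) : Set (Ck hab γ k) :=
  {u | ∀ σ c r : ℝ, σ ^ 2 = 1 → 0 < r → (∀ x, |x - c| ≤ r → x ∈ Icc a b) →
    ∀ G, ¬ IsHalfExtension σ c r (pullback hab γ u.toFun) G}

theorem nowhereExtendable_nonempty (hF : IsAnalyticExtension γ V F) :
    (nowhereExtendable hab γ k).Nonempty := by
  obtain ⟨v, hv, hne⟩ := exists_contDiff_not_isHalfExtension
  let u : range γ → ℂ := fun z => v z.2.choose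
  have hu : ∀ x ∈ Icc a b, pullback hab γ u x = v x := by
    intro x hx
    rw [pullback_of_mem hab u hx]
    have h := (mem_range_self (f := γ) ⟨x, hx⟩).choose_spec
    exact congrArg (fun t : Icc a b => v t) (hF.injective_curve h)
  have huk : u ∈ ckSubmodule hab γ k :=
    (hv.contDiffOn.of_le (by exact_mod_cast le_top)).congr hu
  refine ⟨⟨u, huk⟩, fun σ c r hσ hr hI G hG => hne σ c r hσ hr G (hG.congr fun x hx => ?_)⟩
  exact hu x (hI x hx)

/-- On the real line `ε ↦ u + ε u₀`, each rational half-square excludes at most one `ε`; the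
countable set of excluded values has dense complement, so `ε` can tend to `0` while avoiding it. -/
theorem dense_nowhereExtendable (hF : IsAnalyticExtension γ V F) :
    Dense (nowhereExtendable hab γ k) := by
  obtain ⟨u₀, hu₀⟩ := nowhereExtendable_nonempty (hab := hab) (k := k) hF
  intro u
  let p : ℝ → Ck hab γ k := fun ε => u + (ε : ℂ) • u₀
  have hp : Continuous p :=
    continuous_const.add (Complex.continuous_ofReal.smul continuous_const)
  let B : ℤ × ℚ × ℚ → Set ℝ := fun i => {ε | (i.1 : ℝ) ^ 2 = 1 ∧ (0 : ℝ) < i.2.2 ∧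
    (∀ x : ℝ, |x - i.2.1| ≤ i.2.2 → x ∈ Icc a b) ∧
    ∃ G, IsHalfExtension i.1 i.2.1 i.2.2 (pullback hab γ (p ε).toFun) G}
  have hB : ∀ i, (B i).Subsingleton := by
    rintro i ε ⟨hσ, hr, hI, G, hG⟩ δ ⟨-, -, -, H, hH⟩
    by_contra hne
    have hsub := hG.sub hH
    have hne' : ((ε - δ : ℝ) : ℂ) ≠ 0 := by exact_mod_cast sub_ne_zero.2 hne
    have heq : pullback hab γ (p ε).toFun - pullback hab γ (p δ).toFun =
        ((ε - δ : ℝ) : ℂ) • pullback hab γ u₀.toFun := by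
      simp only [p, pullback_add_smul]
      rw [add_sub_add_left_eq_sub, ← sub_smul, Complex.ofReal_sub]
    rw [heq] at hsub
    have h := hsub.const_smul ((ε - δ : ℝ) : ℂ)⁻¹
    rw [smul_smul, inv_mul_cancel₀ hne', one_smul] at h
    exact hu₀ _ _ _ hσ hr hI _ h
  have hcount : (⋃ i, B i).Countable := countable_iUnion fun i => (hB i).countable
  have h0 : (0 : ℝ) ∈ closure (⋃ i, B i)ᶜ := hcount.dense_compl ℝ 0
  have hp0 : p 0 = u := by simp [p]
  rw [← hp0]
  refine closure_mono ?_ (image_closure_subset_closure_image hp (mem_image_of_mem p h0))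
  rintro _ ⟨ε, hε, rfl⟩ σ c r hσ hr hI G hG
  obtain ⟨d, s, -, hs, hds, hG', -⟩ := hG.exists_rat hσ hr
  obtain ⟨m, rfl⟩ := exists_int_eq_of_sq_eq_one hσ
  refine hε (mem_iUnion.2 ⟨(m, d, s), hσ, hs, fun x hx => hI x ?_, G, hG'⟩)
  exact (abs_sub_le x d c).trans (by linarith)

end AnalyticArc

theorem theorem4p35 {a b : ℝ} (hab : a < b) (γ : Set.Icc a b → ℂ) (V : Set ℂ) (F : ℂ → ℂ)
    (hF : AnalyticArc.IsAnalyticExtension γ V F) (k : ℕ∞) :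
    (Dense (AnalyticArc.U₂ hab γ V F k) ∧ IsGδ (AnalyticArc.U₂ hab γ V F k)) ∧
    (Dense (AnalyticArc.U₃ hab γ V F k) ∧ IsGδ (AnalyticArc.U₃ hab γ V F k)) ∧
    (Dense (AnalyticArc.U₄ hab γ V F k) ∧ IsGδ (AnalyticArc.U₄ hab γ V F k)) ∧
    (Dense (AnalyticArc.U₅ hab γ k) ∧ IsGδ (AnalyticArc.U₅ hab γ k)) := by
  have hdense := AnalyticArc.dense_nowhereExtendable (hab := hab) (k := k) hF
  have hside : ∀ σ : ℝ, σ ^ 2 = 1 → ∀ u ∈ AnalyticArc.nowhereExtendable hab γ k,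
      ¬ AnalyticArc.ExtendableFromSide γ (AnalyticArc.side σ V F) u.toFun := by
    intro σ hσ u hu h
    obtain ⟨c, r, hr, hI, -, G, hG⟩ := hF.exists_isHalfExtension hab hσ h
    exact hu σ c r hσ hr hI G hG
  have h1 : (1 : ℝ) ^ 2 = 1 := by norm_num
  have h2 : (-1 : ℝ) ^ 2 = 1 := by norm_num
  have hplus := hside 1 h1
  have hminus := hside (-1) h2
  have gplus := AnalyticArc.isGδ_not_extendableFromSide (hab := hab) (k := k) hF h1
  have gminus := AnalyticArc.isGδ_not_extendableFromSide (hab := hab) (k := k) hF h2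
  rw [AnalyticArc.side_one] at hplus gplus
  rw [AnalyticArc.side_neg_one] at hminus gminus
  refine ⟨⟨hdense.mono hplus, gplus⟩, ⟨hdense.mono hminus, gminus⟩,
    ⟨hdense.mono fun u hu => ⟨hplus u hu, hminus u hu⟩, gplus.inter gminus⟩,
    ⟨hdense.mono fun u hu h => ?_, AnalyticArc.isGδ_not_extendableToDisc hF⟩⟩
  -- An extension to a disc restricts to a half-extension, which the dense set already excludes.
  obtain ⟨c, r, hr, hI, -, f, hf⟩ := hF.exists_isDiscExtension hab h
  exact hu 1 c r h1 hr hI f (hf.isHalfExtension h1 hr)
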